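/- Let $A$ and $B$ be finite-dimensional quantum systems with $\dim A \ge 2$. Let $\mathcal{E}$ be a unital, completely positive, trace-preserving conditional expectation from the algebra of operators on $B$ onto a unital $*$-subalgebra $N$ (that is, $\mathcal{E}$ is linear, takes values in $N$, fixes every element of $N$, and satisfies $\mathcal{E}(SXT) = S\,\mathcal{E}(X)\,T$ for all $S,T \in N$ and all $X$), and assume that $\mathcal{E} \neq \mathrm{Id}$. For $t > 0$ put \[ \Phi^t(X) = e^{-t} X + (1 - e^{-t})\, \mathcal{E}(X). \] For a density matrix $\rho$ on $A \otimes B$ with marginals $\rho^A, \rho^B$, let $I[A:B](\rho) = H(\rho^A) + H(\rho^B) - H(\rho)$ be the quantum mutual information, where $H(\sigma) = -\operatorname{tr}(\sigma \ln \sigma)$. Then for every $t > 0$ (in particular for arbitrarily small $t$) and every real $K$ there is a density matrix $\rho$ on $A \otimes B$ such that $I[A:B]\big((\mathrm{Id}^A \otimes \Phi^t)(\rho)\big) > 0$ and \[ \frac{I[A:B](\rho)}{I[A:B]\big((\mathrm{Id}^A \otimes \Phi^t)(\rho)\big)} > K . \] -/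

import Mathlib

open scoped Kronecker ComplexOrder

/-- `ρ` is a state (density matrix): positive semidefinite with trace one. -/
def IsState {n : Type*} [Fintype n] (ρ : Matrix n n ℂ) : Prop :=
  ρ.PosSemidef ∧ ρ.trace = 1

/-- The von Neumann entropy `H(ρ) = -tr (ρ log ρ)` (natural logarithm, `0 log 0 = 0`). -/
noncomputable def vonNeumannEntropy {n : Type*} [Fintype n] [DecidableEq n]
    (ρ : Matrix n n ℂ) : ℝ :=
  (cfc Real.negMulLog ρ).trace.re

/-- The marginal `ρ^A = tr_B ρ` of a matrix on the bipartite system `A ⊗ B`. -/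
def marginalA {a b : Type*} [Fintype b] (ρ : Matrix (a × b) (a × b) ℂ) : Matrix a a ℂ :=
  Matrix.of fun i i' => ∑ j, ρ (i, j) (i', j)

/-- The marginal `ρ^B = tr_A ρ` of a matrix on the bipartite system `A ⊗ B`. -/
def marginalB {a b : Type*} [Fintype a] (ρ : Matrix (a × b) (a × b) ℂ) : Matrix b b ℂ :=
  Matrix.of fun j j' => ∑ i, ρ (i, j) (i, j')

/-- The quantum mutual information `I[A:B](ρ) = H(ρ^A) + H(ρ^B) - H(ρ)`. -/
noncomputable def mutualInformation {a b : Type*} [Fintype a] [DecidableEq a]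
    [Fintype b] [DecidableEq b] (ρ : Matrix (a × b) (a × b) ℂ) : ℝ :=
  vonNeumannEntropy (marginalA ρ) + vonNeumannEntropy (marginalB ρ) - vonNeumannEntropy ρ

/-- The map `Id^A ⊗ Φ` on matrices over `A ⊗ B`: it applies `Φ` to every `B`-block. -/
def idTensor {a b : Type*} (Φ : Matrix b b ℂ →ₗ[ℂ] Matrix b b ℂ) :
    Matrix (a × b) (a × b) ℂ →ₗ[ℂ] Matrix (a × b) (a × b) ℂ where
  toFun X := Matrix.of fun p q => Φ (Matrix.of fun j j' => X (p.1, j) (q.1, j')) p.2 q.2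
  map_add' X Y := by
    ext p q
    exact congrFun (congrFun (Φ.map_add (Matrix.of fun j j' => X (p.1, j) (q.1, j'))
      (Matrix.of fun j j' => Y (p.1, j) (q.1, j'))) p.2) q.2
  map_smul' c X := by
    ext p q
    exact congrFun (congrFun
      (Φ.map_smul c (Matrix.of fun j j' => X (p.1, j) (q.1, j'))) p.2) q.2

/-- On product matrices `Id^A ⊗ Φ` acts as expected. -/
theorem idTensor_kronecker {a b : Type*} (Φ : Matrix b b ℂ →ₗ[ℂ] Matrix b b ℂ)
    (X : Matrix a a ℂ) (Y : Matrix b b ℂ) : idTensor Φ (X ⊗ₖ Y) = X ⊗ₖ Φ Y := by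
  ext p q
  exact congrFun (congrFun (Φ.map_smul (X p.1 q.1) Y) p.2) q.2

section CompletelyPositive

open scoped Matrix.Norms.L2Operator MatrixOrder CStarAlgebra

/-- Complete positivity of a linear map on the C⋆-algebra of complex matrices
(with the operator norm and the Loewner order). -/
def IsCompletelyPositive {b : Type*} [Fintype b] [DecidableEq b]
    (Φ : Matrix b b ℂ →ₗ[ℂ] Matrix b b ℂ) : Prop :=
  ∃ Ψ : Matrix b b ℂ →CP Matrix b b ℂ, Ψ.toLinearMap = Φ

end CompletelyPositive

/-- `E` is a conditional expectation onto the unital *-subalgebra `N`: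
a projection onto `N` that is an `N`-bimodule map. -/
structure IsConditionalExpectation {b : Type*} [Fintype b] [DecidableEq b]
    (N : StarSubalgebra ℂ (Matrix b b ℂ)) (E : Matrix b b ℂ →ₗ[ℂ] Matrix b b ℂ) : Prop where
  apply_mem : ∀ X, E X ∈ N
  apply_of_mem : ∀ X ∈ N, E X = X
  bimodule : ∀ S ∈ N, ∀ T ∈ N, ∀ X, E (S * X * T) = S * E X * T

/-- The channel `Φ^t(ρ) = e^{-t} ρ + (1 - e^{-t}) E(ρ)`. -/
noncomputable def replaceChannel {b : Type*} (E : Matrix b b ℂ →ₗ[ℂ] Matrix b b ℂ) (t : ℝ) :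
    Matrix b b ℂ →ₗ[ℂ] Matrix b b ℂ :=
  Real.exp (-t) • LinearMap.id + (1 - Real.exp (-t)) • E

/-!
The states with an unbounded ratio are perturbations of a product state, classical on `A`. As
`E` is not the identity, it moves some pure state `P`. Put `χ = E P`, and for small `ε > 0` let `ρ`
carry `P` and `(1 - ε) P + ε χ` with probability `1 / 2` each, conditioned on two labels of `A`.
The mutual information of `ρ` is the Holevo information of these two states
(`exists_isState_mutualInformation_eq`), and the channel acts on the two states separately.

Before the channel, the mutual information is at least of order `ε`: it is no less than half the
relative entropy of `P` to the midpoint `m`, and as `P` is a projection,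
`D(P‖m) ≥ 1 - tr (m P)`, which is linear in `ε` (`one_sub_trace_mul_le_holevoInformation`). The slope
is positive because a state `χ ≠ P` satisfies `tr (χ P) < 1`.

The channel maps `P` to `τ = e^{-t} P + (1 - e^{-t}) χ` and fixes `χ`. Since `χ ≤ τ / (1 - e^{-t})`,
the perturbation `ε (χ - τ)` stays within the support of `τ`, where the entropy is smooth. The mutual
information after the channel is at most half the relative entropy to `τ`
(`holevoInformation_le_relativeEntropy`), which is of order `ε²` (`exists_relativeEntropy_le`).
It is positive as `χ ≠ τ` (`holevoInformation_pos`). So the ratio grows at least like `1 / ε`.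

All estimates of the relative entropy come from scalar inequalities for `y log y - y log x`, summed
over pairs of eigenvalues with the squared overlaps of the eigenvectors as weights
(`relativeEntropy_eq_sum`).
-/

open Matrix

/-! ### Spectral overlaps and trace formulas -/

section SpectralPairs

variable {n : Type*} [Fintype n] [DecidableEq n] {X Y : Matrix n n ℂ}

/-- The overlap `|⟨uᵢ, vⱼ⟩|²` between the eigenvector `uᵢ` of `X` and the eigenvector `vⱼ` of `Y`,
for the eigenbases chosen by Mathlib. -/
noncomputable def spectralWeight (hX : X.IsHermitian) (hY : Y.IsHermitian) (i j : n) : ℝ :=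
  ‖(star (hX.eigenvectorUnitary : Matrix n n ℂ) * (hY.eigenvectorUnitary : Matrix n n ℂ)) i j‖ ^ 2

theorem spectralWeight_nonneg (hX : X.IsHermitian) (hY : Y.IsHermitian) (i j : n) :
    0 ≤ spectralWeight hX hY i j := sq_nonneg _

/-- Traces of products `f(X) g(Y)` are sums over pairs of eigenvalues. This turns scalar
inequalities between the eigenvalues into trace inequalities for non-commuting matrices. -/
theorem trace_cfc_mul_cfc (hX : X.IsHermitian) (hY : Y.IsHermitian) (f g : ℝ → ℝ) :
    (cfc f X * cfc g Y).trace.re =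
      ∑ i, ∑ j, spectralWeight hX hY i j * (f (hX.eigenvalues i) * g (hY.eigenvalues j)) := by
  rw [hX.cfc_eq, hY.cfc_eq, IsHermitian.cfc, IsHermitian.cfc, Unitary.conjStarAlgAut_apply,
    Unitary.conjStarAlgAut_apply]
  set U := (hX.eigenvectorUnitary : Matrix n n ℂ) with hU
  set V := (hY.eigenvectorUnitary : Matrix n n ℂ) with hV
  have hcyc (D E : Matrix n n ℂ) :
      (U * D * star U * (V * E * star V)).trace = (D * (star U * V) * E * star (star U * V)).trace := by
    rw [star_mul, star_star, show U * D * star U * (V * E * star V)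
      = U * (D * (star U * V) * E * star V) by simp only [mul_assoc], trace_mul_comm]
    simp only [mul_assoc]
  rw [hcyc, trace, Complex.re_sum]
  refine Finset.sum_congr rfl fun i _ => ?_
  rw [diag_apply, mul_apply, Complex.re_sum]
  refine Finset.sum_congr rfl fun j _ => ?_
  rw [mul_diagonal, diagonal_mul, star_apply, spectralWeight, ← hU, ← hV]
  set z := (star U * V) i j
  simp only [Function.comp_apply, Complex.coe_algebraMap, RCLike.star_def]
  have : (f (hX.eigenvalues i) : ℂ) * z * (g (hY.eigenvalues j) : ℂ) * (starRingEnd ℂ) z =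
      ((f (hX.eigenvalues i) * g (hY.eigenvalues j) * ‖z‖ ^ 2 : ℝ) : ℂ) := by
    push_cast
    rw [← Complex.mul_conj']
    ring
  erw [this]
  rw [Complex.ofReal_re]
  ring

theorem cfc_id_of_isHermitian (hX : X.IsHermitian) : cfc (fun x : ℝ => x) X = X :=
  cfc_id' ℝ X hX

theorem cfc_one_of_isHermitian (hX : X.IsHermitian) : cfc (fun _ : ℝ => 1) X = 1 :=
  cfc_const_one ℝ X hX

theorem cfc_sq_of_isHermitian (hX : X.IsHermitian) : cfc (fun x : ℝ => x ^ 2) X = X * X := by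
  rw [← pow_two]
  exact cfc_pow_id X 2 hX

end SpectralPairs

/-! ### Relative entropy -/

section Auxiliary

variable {n : Type*} [Fintype n] {X : Matrix n n ℂ}

theorem trace_sub_mul_sub_re (X Y : Matrix n n ℂ) :
    ((Y - X) * (Y - X)).trace.re =
      (X * X).trace.re - 2 * (X * Y).trace.re + (Y * Y).trace.re := by
  rw [sub_mul, mul_sub, mul_sub]
  simp only [trace_sub, Complex.sub_re]
  rw [trace_mul_comm Y X]
  ring

theorem trace_mul_self_re_pos (hX : X.IsHermitian) (h : X ≠ 0) : 0 < (X * X).trace.re := by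
  have h0 : (Xᴴ * X).trace ≠ 0 := fun h1 => h (trace_conjTranspose_mul_self_eq_zero_iff.1 h1)
  have h1 := (posSemidef_conjTranspose_mul_self X).trace_nonneg
  rw [hX.eq] at h0 h1
  rw [Complex.le_def] at h1
  refine lt_of_le_of_ne h1.1 fun h2 => h0 (Complex.ext h2.symm h1.2.symm)

/-- The scalar form of the bound of the relative entropy by the `χ²`-divergence. -/
theorem mul_log_sub_mul_log_le {x y l : ℝ} (hl : 0 < l) (hx : x = 0 ∨ l ≤ x) (hy : 0 ≤ y)
    (h : x = 0 → y = 0) : y * Real.log y - y * Real.log x ≤ y - x + (y - x) ^ 2 / l := by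
  rcases hx with rfl | hx
  · simp [h rfl]
  have hx0 : 0 < x := hl.trans_le hx
  have h2 : y * Real.log y - y * Real.log x ≤ y - x + (y - x) ^ 2 / x := by
    rcases hy.eq_or_lt with rfl | hy
    · field_simp; simp
    have := Real.log_le_sub_one_of_pos (div_pos hy hx0)
    rw [Real.log_div hy.ne' hx0.ne'] at this
    calc _ = y * (Real.log y - Real.log x) := by ring
      _ ≤ y * (y / x - 1) := by gcongr
      _ = _ := by field_simp; ring
  exact h2.trans (by gcongr)

theorem le_mul_log_sub_mul_log {x y : ℝ} (hx : 0 ≤ x) (hx1 : x ≤ 1) (hy : 0 ≤ y) (hy1 : y ≤ 1)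
    (h : x = 0 → y = 0) : y - x + (y - x) ^ 2 / 4 ≤ y * Real.log y - y * Real.log x := by
  rcases hy.eq_or_lt with rfl | hy
  · simp; nlinarith
  have hx0 : 0 < x := lt_of_le_of_ne hx fun h0 => hy.ne' (h h0.symm)
  -- With `x = u²` and `y = v²`, the bound `log (u / v) ≤ u / v - 1` shows that
  -- `y log y - y log x - y + x ≥ (v - u)²`, and `v + u ≤ 2`.
  obtain ⟨u, hu, rfl⟩ : ∃ u, 0 < u ∧ x = u ^ 2 :=
    ⟨√x, Real.sqrt_pos.2 hx0, (Real.sq_sqrt hx).symm⟩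
  obtain ⟨v, hv, rfl⟩ : ∃ v, 0 < v ∧ y = v ^ 2 :=
    ⟨√y, Real.sqrt_pos.2 hy, (Real.sq_sqrt hy.le).symm⟩
  have hu1 : u ≤ 1 := by nlinarith
  have hv1 : v ≤ 1 := by nlinarith
  have h1 := Real.log_le_sub_one_of_pos (div_pos hu hv)
  rw [Real.log_div hu.ne' hv.ne'] at h1
  have h2 : v ^ 2 * (Real.log u - Real.log v) ≤ u * v - v ^ 2 := by
    calc _ ≤ v ^ 2 * (u / v - 1) := by gcongr
      _ = _ := by field_simp
  rw [Real.log_pow, Real.log_pow]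
  have h3 : (v ^ 2 - u ^ 2) ^ 2 ≤ 4 * (v - u) ^ 2 := by
    rw [show (v ^ 2 - u ^ 2) ^ 2 = (v + u) ^ 2 * (v - u) ^ 2 by ring]
    gcongr
    nlinarith
  push_cast
  nlinarith

theorem one_sub_le_mul_log {x y : ℝ} (hx : 0 ≤ x) (hy : y = 0 ∨ y = 1) (h : x = 0 → y = 0) :
    y - x * y ≤ y * Real.log y - y * Real.log x := by
  rcases hy with rfl | rfl
  · simp
  · have := Real.log_le_sub_one_of_pos (lt_of_le_of_ne hx fun h0 => one_ne_zero (h h0.symm))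
    simp; linarith

end Auxiliary

section RelativeEntropy

variable {n : Type*} [Fintype n] [DecidableEq n] {X Y : Matrix n n ℂ}

/-- The relative entropy `D(Y‖X) = tr Y (log Y - log X)`. As `Real.log 0 = 0`, this has the usual
meaning only when the kernel of `X` is contained in that of `Y`; the lemmas below
assume `Y ≤ c X` for some real `c`, which guarantees this. -/
noncomputable def relativeEntropy (Y X : Matrix n n ℂ) : ℝ :=
  -vonNeumannEntropy Y - (cfc Real.log X * Y).trace.re

theorem relativeEntropy_eq_sum (hX : X.IsHermitian) (hY : Y.IsHermitian) :
    relativeEntropy Y X = ∑ i, ∑ j, spectralWeight hX hY i j *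
      (hY.eigenvalues j * Real.log (hY.eigenvalues j)
        - hY.eigenvalues j * Real.log (hX.eigenvalues i)) := by
  have h1 := trace_cfc_mul_cfc hX hY (fun _ => 1) Real.negMulLog
  have h2 := trace_cfc_mul_cfc hX hY Real.log (fun y => y)
  rw [cfc_one_of_isHermitian hX, one_mul] at h1
  rw [cfc_id_of_isHermitian hY] at h2
  rw [relativeEntropy, vonNeumannEntropy, h1, h2, ← Finset.sum_neg_distrib,
    ← Finset.sum_sub_distrib]
  refine Finset.sum_congr rfl fun i _ => ?_
  rw [← Finset.sum_neg_distrib, ← Finset.sum_sub_distrib]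
  refine Finset.sum_congr rfl fun j _ => ?_
  rw [Real.negMulLog]
  ring

theorem sum_spectralWeight_mul_quadratic (hX : X.IsHermitian) (hY : Y.IsHermitian)
    (p q r s t : ℝ) :
    ∑ i, ∑ j, spectralWeight hX hY i j * (p * hX.eigenvalues i + q * hY.eigenvalues j
        + r * hX.eigenvalues i ^ 2 + s * (hX.eigenvalues i * hY.eigenvalues j)
        + t * hY.eigenvalues j ^ 2) =
      p * X.trace.re + q * Y.trace.re + r * (X * X).trace.re + s * (X * Y).trace.re
        + t * (Y * Y).trace.re := by
  have h1 := trace_cfc_mul_cfc hX hY (fun x => x) (fun _ => 1)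
  have h2 := trace_cfc_mul_cfc hX hY (fun _ => 1) (fun y => y)
  have h3 := trace_cfc_mul_cfc hX hY (fun x => x ^ 2) (fun _ => 1)
  have h4 := trace_cfc_mul_cfc hX hY (fun x => x) (fun y => y)
  have h5 := trace_cfc_mul_cfc hX hY (fun _ => 1) (fun y => y ^ 2)
  simp only [cfc_one_of_isHermitian hX, cfc_one_of_isHermitian hY, cfc_id_of_isHermitian hX,
    cfc_id_of_isHermitian hY, cfc_sq_of_isHermitian hX, cfc_sq_of_isHermitian hY,
    one_mul, mul_one] at h1 h2 h3 h4 h5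
  rw [h1, h2, h3, h4, h5]
  simp only [Finset.mul_sum, ← Finset.sum_add_distrib]
  refine Finset.sum_congr rfl fun i _ => Finset.sum_congr rfl fun j _ => ?_
  ring

theorem trace_mul_re_nonneg (hX : X.PosSemidef) (hY : Y.PosSemidef) :
    0 ≤ (X * Y).trace.re := by
  have h := trace_cfc_mul_cfc hX.1 hY.1 (fun x => x) (fun y => y)
  rw [cfc_id_of_isHermitian hX.1, cfc_id_of_isHermitian hY.1] at h
  rw [h]
  exact Finset.sum_nonneg fun i _ => Finset.sum_nonneg fun j _ =>
    mul_nonneg (spectralWeight_nonneg _ _ _ _)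
      (mul_nonneg (hX.eigenvalues_nonneg i) (hY.eigenvalues_nonneg j))

theorem posSemidef_cfc (hX : X.IsHermitian) {f : ℝ → ℝ} (hf : ∀ x, 0 ≤ f x) :
    (cfc f X).PosSemidef := by
  rw [hX.cfc_eq, IsHermitian.cfc, Unitary.conjStarAlgAut_apply]
  refine PosSemidef.mul_mul_conjTranspose_same (PosSemidef.diagonal fun i => ?_) _
  simpa using hf _

/-- If `Y ≤ c X`, then eigenvectors of `X` in its kernel are orthogonal to those eigenvectors of `Y`
that have a nonzero eigenvalue. -/
theorem spectralWeight_mul_eigenvalues_eq_zero (hX : X.PosSemidef) (hY : Y.PosSemidef) {c : ℝ}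
    (hc : (c • X - Y).PosSemidef) {i : n} (hi : hX.1.eigenvalues i = 0) (j : n) :
    spectralWeight hX.1 hY.1 i j * hY.1.eigenvalues j = 0 := by
  set f : ℝ → ℝ := fun x => if x = 0 then 1 else 0 with hf
  have hP : (cfc f X).PosSemidef := posSemidef_cfc hX.1 fun x => by rw [hf]; positivity
  -- `cfc f X` is the projection onto the kernel of `X`.
  have hPX : (cfc f X * X).trace.re = 0 := by
    have h : cfc f X * X = 0 := by
      have hfin : (spectrum ℝ X).Finite := finite_real_spectrum
      calc cfc f X * X = cfc f X * cfc (fun x : ℝ => x) X := by rw [cfc_id_of_isHermitian hX.1]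
        _ = cfc (fun x : ℝ => f x * x) X :=
          (cfc_mul f (fun x : ℝ => x) X (hfin.continuousOn f) (hfin.continuousOn _)).symm
        _ = cfc (fun _ : ℝ => 0) X := by
          congr 1
          funext x
          by_cases hx : x = 0 <;> simp [hf, hx]
        _ = 0 := cfc_const_zero ℝ X
    simp [h]
  have hPY : (cfc f X * Y).trace.re ≤ 0 := by
    have h := trace_mul_re_nonneg hP hc
    rw [mul_sub, trace_sub, mul_smul_comm, trace_smul, Complex.sub_re, Complex.smul_re, hPX,
      smul_zero] at h
    linarith
  have h := trace_cfc_mul_cfc hX.1 hY.1 f (fun y => y)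
  rw [cfc_id_of_isHermitian hY.1] at h
  have hnn : ∀ i j, 0 ≤ spectralWeight hX.1 hY.1 i j *
      (f (hX.1.eigenvalues i) * hY.1.eigenvalues j) := fun i j =>
    mul_nonneg (spectralWeight_nonneg _ _ _ _)
      (mul_nonneg (by simp only [hf]; positivity) (hY.eigenvalues_nonneg j))
  have h0 : ∑ i, ∑ j, spectralWeight hX.1 hY.1 i j *
      (f (hX.1.eigenvalues i) * hY.1.eigenvalues j) = 0 :=
    le_antisymm (h ▸ hPY) (Finset.sum_nonneg fun i _ => Finset.sum_nonneg fun j _ => hnn i j)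
  rw [Finset.sum_eq_zero_iff_of_nonneg fun i _ => Finset.sum_nonneg fun j _ => hnn i j] at h0
  have h1 := h0 i (Finset.mem_univ i)
  rw [Finset.sum_eq_zero_iff_of_nonneg fun j _ => hnn i j] at h1
  simpa [hf, hi] using h1 j (Finset.mem_univ j)

/-- An upper bound for `y log y - y log x` by a quadratic polynomial in the eigenvalues `x` of `X`
and `y` of `Y` bounds `D(Y‖X)` by the corresponding traces. Pairs with `x = 0 ≠ y` may be ignored,
since their overlap vanishes. -/
theorem relativeEntropy_le_of_le (hX : X.PosSemidef) (hY : Y.PosSemidef) {c : ℝ}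
    (hc : (c • X - Y).PosSemidef) (p q r s t : ℝ)
    (h : ∀ i j, (hX.1.eigenvalues i = 0 → hY.1.eigenvalues j = 0) →
      hY.1.eigenvalues j * Real.log (hY.1.eigenvalues j)
        - hY.1.eigenvalues j * Real.log (hX.1.eigenvalues i) ≤
      p * hX.1.eigenvalues i + q * hY.1.eigenvalues j
        + r * hX.1.eigenvalues i ^ 2 + s * (hX.1.eigenvalues i * hY.1.eigenvalues j)
        + t * hY.1.eigenvalues j ^ 2) :
    relativeEntropy Y X ≤ p * X.trace.re + q * Y.trace.re + r * (X * X).trace.re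
      + s * (X * Y).trace.re + t * (Y * Y).trace.re := by
  rw [relativeEntropy_eq_sum hX.1 hY.1, ← sum_spectralWeight_mul_quadratic hX.1 hY.1]
  refine Finset.sum_le_sum fun i _ => Finset.sum_le_sum fun j _ => ?_
  by_cases hw : spectralWeight hX.1 hY.1 i j = 0
  · simp [hw]
  · refine mul_le_mul_of_nonneg_left (h i j fun hi => ?_) (spectralWeight_nonneg _ _ _ _)
    exact (mul_eq_zero.1 (spectralWeight_mul_eigenvalues_eq_zero hX hY hc hi j)).resolve_left hw

/-- The counterpart of `relativeEntropy_le_of_le` for lower bounds. -/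
theorem le_relativeEntropy_of_le (hX : X.PosSemidef) (hY : Y.PosSemidef) {c : ℝ}
    (hc : (c • X - Y).PosSemidef) (p q r s t : ℝ)
    (h : ∀ i j, (hX.1.eigenvalues i = 0 → hY.1.eigenvalues j = 0) →
      p * hX.1.eigenvalues i + q * hY.1.eigenvalues j
        + r * hX.1.eigenvalues i ^ 2 + s * (hX.1.eigenvalues i * hY.1.eigenvalues j)
        + t * hY.1.eigenvalues j ^ 2 ≤
      hY.1.eigenvalues j * Real.log (hY.1.eigenvalues j)
        - hY.1.eigenvalues j * Real.log (hX.1.eigenvalues i)) :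
    p * X.trace.re + q * Y.trace.re + r * (X * X).trace.re
      + s * (X * Y).trace.re + t * (Y * Y).trace.re ≤ relativeEntropy Y X := by
  rw [relativeEntropy_eq_sum hX.1 hY.1, ← sum_spectralWeight_mul_quadratic hX.1 hY.1]
  refine Finset.sum_le_sum fun i _ => Finset.sum_le_sum fun j _ => ?_
  by_cases hw : spectralWeight hX.1 hY.1 i j = 0
  · simp [hw]
  · refine mul_le_mul_of_nonneg_left (h i j fun hi => ?_) (spectralWeight_nonneg _ _ _ _)
    exact (mul_eq_zero.1 (spectralWeight_mul_eigenvalues_eq_zero hX hY hc hi j)).resolve_left hw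

theorem IsState.eigenvalues_le_one {ρ : Matrix n n ℂ} (hρ : IsState ρ) (i : n) :
    hρ.1.1.eigenvalues i ≤ 1 := by
  have h : ∑ i, hρ.1.1.eigenvalues i = 1 := by
    have := congrArg Complex.re (hρ.2.symm.trans hρ.1.1.trace_eq_sum_eigenvalues)
    simpa using this.symm
  rw [← h]
  exact Finset.single_le_sum (fun i _ => hρ.1.eigenvalues_nonneg i) (Finset.mem_univ i)

/-- A Pinsker-type inequality, which implies that the relative entropy is nonnegative. -/
theorem IsState.le_relativeEntropy (hX : IsState X) (hY : IsState Y) {c : ℝ}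
    (hc : (c • X - Y).PosSemidef) :
    ((Y - X) * (Y - X)).trace.re / 4 ≤ relativeEntropy Y X := by
  have h := le_relativeEntropy_of_le hX.1 hY.1 hc (-1) 1 (1 / 4) (-(1 / 2)) (1 / 4) fun i j hij => by
    refine le_trans (le_of_eq ?_) (le_mul_log_sub_mul_log (hX.1.eigenvalues_nonneg i)
      (hX.eigenvalues_le_one i) (hY.1.eigenvalues_nonneg j) (hY.eigenvalues_le_one j) hij)
    ring
  rw [hX.2, hY.2] at h
  rw [trace_sub_mul_sub_re]
  simp at h
  linarith

/-- On matrices dominated by a multiple of `X`, the relative entropy to `X` is at most quadratic in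
the distance to `X`. The constant `l` depends on `X` alone: it is a positive lower bound for the
nonzero eigenvalues of `X`. -/
theorem exists_relativeEntropy_le (hX : X.PosSemidef) : ∃ l : ℝ, 0 < l ∧
    ∀ (Y : Matrix n n ℂ) (c : ℝ), Y.PosSemidef → Y.trace = X.trace → (c • X - Y).PosSemidef →
      relativeEntropy Y X ≤ ((Y - X) * (Y - X)).trace.re / l := by
  obtain ⟨l, hl, h⟩ : ∃ l : ℝ, 0 < l ∧
      ∀ i, hX.1.eigenvalues i = 0 ∨ l ≤ hX.1.eigenvalues i := by
    let s : Finset ℝ := insert 1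
      ((Finset.univ.image hX.1.eigenvalues).filter (fun x => 0 < x))
    have hs : s.Nonempty := Finset.insert_nonempty _ _
    refine ⟨s.min' hs, (Finset.lt_min'_iff _ _).2 fun x hx => ?_, fun i => ?_⟩
    · simp only [s, Finset.mem_insert, Finset.mem_filter] at hx
      rcases hx with rfl | hx
      · exact one_pos
      · exact hx.2
    · refine (hX.eigenvalues_nonneg i).eq_or_lt.imp Eq.symm fun hi => s.min'_le _ ?_
      simp [s, hi]
  refine ⟨l, hl, fun Y c hY hYX hc => ?_⟩
  have h := relativeEntropy_le_of_le hX hY hc (-1) 1 (1 / l) (-(2 / l)) (1 / l) fun i j hij => by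
    refine (mul_log_sub_mul_log_le hl (h i) (hY.eigenvalues_nonneg j) hij).trans (le_of_eq ?_)
    ring
  rw [trace_sub_mul_sub_re]
  rw [hYX] at h
  refine h.trans (le_of_eq ?_)
  ring

/-- For a projection `Y`, the relative entropy to `X` is at least `tr Y (1 - X)`, which is of first
order in the distance from `X` to `Y`. -/
theorem le_relativeEntropy_of_isIdempotentElem (hX : X.PosSemidef) (hY : Y.PosSemidef)
    (hYY : Y * Y = Y) {c : ℝ} (hc : (c • X - Y).PosSemidef) :
    Y.trace.re - (X * Y).trace.re ≤ relativeEntropy Y X := by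
  have hev : ∀ j, hY.1.eigenvalues j = 0 ∨ hY.1.eigenvalues j = 1 := fun j => by
    have hj := IsIdempotentElem.spectrum_subset ℝ (p := Y) hYY (hY.1.eigenvalues_mem_spectrum_real j)
    simpa using hj
  have h := le_relativeEntropy_of_le hX hY hc 0 1 0 (-1) 0 fun i j hij => by
    refine le_trans (le_of_eq ?_) (one_sub_le_mul_log (hX.eigenvalues_nonneg i) (hev j) hij)
    ring
  linarith

theorem IsState.trace_mul_self_re_le_one {ρ : Matrix n n ℂ} (hρ : IsState ρ) :
    (ρ * ρ).trace.re ≤ 1 := by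
  have h := sum_spectralWeight_mul_quadratic hρ.1.1 hρ.1.1 1 0 (-1) 0 0
  have : 0 ≤ ∑ i, ∑ j, spectralWeight hρ.1.1 hρ.1.1 i j * (1 * hρ.1.1.eigenvalues i
      + 0 * hρ.1.1.eigenvalues j + -1 * hρ.1.1.eigenvalues i ^ 2
      + 0 * (hρ.1.1.eigenvalues i * hρ.1.1.eigenvalues j) + 0 * hρ.1.1.eigenvalues j ^ 2) := by
    refine Finset.sum_nonneg fun i _ => Finset.sum_nonneg fun j _ =>
      mul_nonneg (spectralWeight_nonneg _ _ _ _) ?_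
    have h0 := hρ.1.eigenvalues_nonneg i
    have h1 := hρ.eigenvalues_le_one i
    nlinarith
  rw [h, hρ.2] at this
  simp at this
  linarith

end RelativeEntropy

/-! ### Mutual information of classical-quantum matrices -/

section ClassicalQuantum

variable {a b : Type*} [DecidableEq a]

/-- The block-diagonal matrix `∑ i, |i⟩⟨i| ⊗ f i` on `A ⊗ B`. Mathlib's `blockDiagonal` has the block
index in the second component, hence the swap. -/
def classicalQuantum (f : a → Matrix b b ℂ) : Matrix (a × b) (a × b) ℂ :=
  (blockDiagonal f).submatrix Prod.swap Prod.swap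

theorem classicalQuantum_apply (f : a → Matrix b b ℂ) (p q : a × b) :
    classicalQuantum f p q = if p.1 = q.1 then f p.1 p.2 q.2 else 0 := by
  simp [classicalQuantum, blockDiagonal_apply]

theorem idTensor_classicalQuantum (Φ : Matrix b b ℂ →ₗ[ℂ] Matrix b b ℂ)
    (f : a → Matrix b b ℂ) :
    idTensor Φ (classicalQuantum f) = classicalQuantum fun i => Φ (f i) := by
  ext p q
  change Φ (of fun j j' => classicalQuantum f (p.1, j) (q.1, j')) p.2 q.2 = _
  simp only [classicalQuantum_apply]
  split_ifs with h
  · rfl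
  · exact congrFun (congrFun (map_zero Φ) p.2) q.2

theorem marginalA_classicalQuantum [Fintype b] (f : a → Matrix b b ℂ) :
    marginalA (classicalQuantum f) = diagonal fun i => (f i).trace := by
  ext i i'
  simp only [marginalA, of_apply, classicalQuantum_apply, diagonal_apply]
  split_ifs <;> simp [trace]

theorem marginalB_classicalQuantum [Fintype a] (f : a → Matrix b b ℂ) :
    marginalB (classicalQuantum f) = ∑ i, f i := by
  ext j j'
  simp [marginalB, classicalQuantum_apply, Matrix.sum_apply]

theorem isHermitian_classicalQuantum {f : a → Matrix b b ℂ} (hf : ∀ i, (f i).IsHermitian) :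
    (classicalQuantum f).IsHermitian := by
  rw [IsHermitian, classicalQuantum, conjTranspose_submatrix, blockDiagonal_conjTranspose]
  simp only [(hf _).eq]

variable [Fintype a] [Fintype b]

theorem isState_classicalQuantum {f : a → Matrix b b ℂ} (hf : ∀ i, (f i).PosSemidef)
    (htr : ∑ i, (f i).trace = 1) : IsState (classicalQuantum f) := by
  constructor
  · have h : classicalQuantum f = ∑ i, (single i i (1 : ℂ)) ⊗ₖ f i := by
      ext p q
      rw [classicalQuantum_apply, Matrix.sum_apply]
      simp only [kroneckerMap_apply, single_apply, ite_mul, one_mul, zero_mul]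
      split_ifs with h
      · simp [h]
      · refine (Finset.sum_eq_zero fun i _ => if_neg fun hi => h (hi.1.symm.trans hi.2)).symm
    rw [h]
    refine posSemidef_sum _ fun i _ => PosSemidef.kronecker ?_ (hf i)
    rw [← diagonal_single]
    refine PosSemidef.diagonal fun j => ?_
    by_cases hj : j = i
    · simp [hj]
    · simp [hj]
  · rw [← htr, trace, Fintype.sum_prod_type]
    simp [classicalQuantum_apply, trace]

variable [DecidableEq b]

/-- The entropy depends on the characteristic polynomial alone; for block-diagonal matrices this
polynomial is the product over the blocks. -/
theorem vonNeumannEntropy_eq_sum_roots {A : Matrix b b ℂ} (hA : A.IsHermitian) :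
    vonNeumannEntropy A = (A.charpoly.roots.map fun z => Real.negMulLog z.re).sum := by
  rw [vonNeumannEntropy, hA.cfc_eq, IsHermitian.cfc, Unitary.conjStarAlgAut_apply, trace_mul_cycle,
    hA.roots_charpoly_eq_eigenvalues]
  simp [trace]

theorem vonNeumannEntropy_diagonal (d : b → ℝ) :
    vonNeumannEntropy (diagonal fun i => (d i : ℂ)) = ∑ i, Real.negMulLog (d i) := by
  rw [vonNeumannEntropy_eq_sum_roots, charpoly_diagonal, Polynomial.roots_prod]
  · simp
  · simp [Finset.prod_ne_zero_iff, Polynomial.X_sub_C_ne_zero]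
  · exact isHermitian_diagonal_of_self_adjoint _ (by ext; simp)

theorem charpoly_classicalQuantum (f : a → Matrix b b ℂ) :
    (classicalQuantum f).charpoly = ∏ i, (f i).charpoly := by
  have h : classicalQuantum f = reindex (Equiv.prodComm b a) (Equiv.prodComm b a)
    (blockDiagonal f) := rfl
  have h2 : charmatrix (blockDiagonal f) = blockDiagonal fun i => charmatrix (f i) := by
    ext p q : 2
    simp only [charmatrix_apply, blockDiagonal_apply, diagonal_apply, Prod.ext_iff]
    split_ifs <;> simp_all
  rw [h, charpoly_reindex, charpoly, h2, det_blockDiagonal]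
  rfl

theorem vonNeumannEntropy_classicalQuantum {f : a → Matrix b b ℂ}
    (hf : ∀ i, (f i).IsHermitian) :
    vonNeumannEntropy (classicalQuantum f) = ∑ i, vonNeumannEntropy (f i) := by
  rw [vonNeumannEntropy_eq_sum_roots (isHermitian_classicalQuantum hf),
    charpoly_classicalQuantum, Polynomial.roots_prod _ _
      (Finset.prod_ne_zero_iff.2 fun i _ => (charpoly_monic _).ne_zero), Multiset.map_bind,
      Multiset.sum_bind]
  exact Finset.sum_congr rfl fun i _ => (vonNeumannEntropy_eq_sum_roots (hf i)).symm

theorem vonNeumannEntropy_smul {X : Matrix b b ℂ} (hX : X.IsHermitian) (c : ℝ) :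
    vonNeumannEntropy (c • X) = c * vonNeumannEntropy X + Real.negMulLog c * X.trace.re := by
  have hfin : (spectrum ℝ X).Finite := finite_real_spectrum
  have h : cfc Real.negMulLog (c • X) = c • cfc Real.negMulLog X + Real.negMulLog c • X := by
    have h1 := cfc_comp_smul c Real.negMulLog X ((hfin.image _).continuousOn _) hX
    rw [← h1]
    conv_rhs => rw [← cfc_smul c Real.negMulLog X (hfin.continuousOn _)]
    nth_rw 3 [← cfc_id_of_isHermitian hX]
    rw [← cfc_smul (Real.negMulLog c) (fun x : ℝ => x) X (hfin.continuousOn _),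
      ← cfc_add _ _ _ (hfin.continuousOn _) (hfin.continuousOn _)]
    congr 1
    funext x
    simp only [smul_eq_mul, Real.negMulLog_mul]
    ring
  rw [vonNeumannEntropy, h, trace_add, trace_smul, trace_smul, Complex.add_re, Complex.smul_re,
    Complex.smul_re]
  rfl

/-- The mutual information of a classical-quantum state is the Holevo information of its
ensemble. The weights `p` need not be normalized: the contributions of their entropy cancel. -/
theorem mutualInformation_classicalQuantum (p : a → ℝ) {X : a → Matrix b b ℂ}
    (hX : ∀ i, (X i).IsHermitian) (htr : ∀ i, (X i).trace = 1) :
    mutualInformation (classicalQuantum fun i => p i • X i) =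
      vonNeumannEntropy (∑ i, p i • X i) - ∑ i, p i * vonNeumannEntropy (X i) := by
  have hA : marginalA (classicalQuantum fun i => p i • X i) = diagonal fun i => (p i : ℂ) := by
    rw [marginalA_classicalQuantum]
    congr 1
    funext i
    rw [trace_smul, htr, Complex.real_smul, mul_one]
  rw [mutualInformation, hA, vonNeumannEntropy_diagonal, marginalB_classicalQuantum,
    vonNeumannEntropy_classicalQuantum fun i => by
      exact (hX i).smul (IsSelfAdjoint.all (p i))]
  simp only [vonNeumannEntropy_smul (hX _), htr, Complex.one_re, mul_one,
    Finset.sum_add_distrib]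
  ring

end ClassicalQuantum

/-! ### Equiprobable pairs of states -/

section HolevoInformation

variable {a b : Type*} [DecidableEq a] [Fintype a] [Fintype b] [DecidableEq b]

/-- The Holevo information `H((X + Y) / 2) - (H(X) + H(Y)) / 2` of the ensemble in which `X` and `Y`
have probability `1 / 2` each. -/
noncomputable def holevoInformation (X Y : Matrix b b ℂ) : ℝ :=
  vonNeumannEntropy ((1 / 2 : ℝ) • X + (1 / 2 : ℝ) • Y)
    - (vonNeumannEntropy X + vonNeumannEntropy Y) / 2

/-- The state `(|0⟩⟨0| ⊗ X + |1⟩⟨1| ⊗ Y) / 2`, for two distinct labels of `A`, has the Holevo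
information of `X` and `Y` as its mutual information, and a map on `B` acts on `X` and `Y`. -/
theorem exists_isState_mutualInformation_eq [Nontrivial a] {X Y : Matrix b b ℂ}
    (hX : IsState X) (hY : IsState Y) :
    ∃ ρ : Matrix (a × b) (a × b) ℂ, IsState ρ ∧ mutualInformation ρ = holevoInformation X Y ∧
      ∀ Φ : Matrix b b ℂ →ₗ[ℂ] Matrix b b ℂ, IsState (Φ X) → IsState (Φ Y) →
        mutualInformation (idTensor Φ ρ) = holevoInformation (Φ X) (Φ Y) := by
  obtain ⟨i₀, i₁, hne⟩ := exists_pair_ne a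
  set p : a → ℝ := fun i => if i = i₀ then 1 / 2 else if i = i₁ then 1 / 2 else 0 with hp
  have key (X Y : Matrix b b ℂ) (hX : IsState X) (hY : IsState Y) :
      mutualInformation (classicalQuantum fun i => p i • if i = i₀ then X else Y)
        = holevoInformation X Y := by
    rw [mutualInformation_classicalQuantum, Fintype.sum_eq_add i₀ i₁ hne,
      Fintype.sum_eq_add i₀ i₁ hne, holevoInformation]
    · simp [hp, hne.symm]
      ring
    · rintro i ⟨h0, h1⟩
      simp [hp, h0, h1]
    · rintro i ⟨h0, h1⟩
      simp [hp, h0, h1]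
    · intro i
      split_ifs
      exacts [hX.1.1, hY.1.1]
    · intro i
      split_ifs
      exacts [hX.2, hY.2]
  refine ⟨classicalQuantum fun i => p i • if i = i₀ then X else Y,
    isState_classicalQuantum (fun i => ?_) ?_, key X Y hX hY, fun Φ hΦX hΦY => ?_⟩
  · refine PosSemidef.smul ?_ ?_
    · split_ifs
      exacts [hX.1, hY.1]
    · simp only [hp]
      positivity
  · rw [Fintype.sum_eq_add i₀ i₁ hne]
    · simp [hp, hne.symm, trace_smul, hX.2, hY.2]
      norm_num
    · rintro i ⟨h0, h1⟩
      simp [hp, h0, h1]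
  · rw [idTensor_classicalQuantum, ← key _ _ hΦX hΦY]
    congr 2
    funext i
    rw [LinearMap.map_smul_of_tower]
    split_ifs <;> rfl

end HolevoInformation

/-! ### Bounds on the Holevo information -/

section ConvexCombinations

variable {b : Type*} {X Y : Matrix b b ℂ}

theorem posSemidef_two_smul_midpoint_sub_left (hY : Y.PosSemidef) :
    ((2 : ℝ) • ((1 / 2 : ℝ) • X + (1 / 2 : ℝ) • Y) - X).PosSemidef := by
  convert hY using 1
  module

theorem posSemidef_two_smul_midpoint_sub_right (hX : X.PosSemidef) :
    ((2 : ℝ) • ((1 / 2 : ℝ) • X + (1 / 2 : ℝ) • Y) - Y).PosSemidef := by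
  convert hX using 1
  module

theorem IsState.convex_combination [Fintype b] (hX : IsState X) (hY : IsState Y) {s t : ℝ} (hs : 0 ≤ s)
    (ht : 0 ≤ t) (hst : s + t = 1) : IsState (s • X + t • Y) := by
  refine ⟨(hX.1.smul hs).add (hY.1.smul ht), ?_⟩
  rw [trace_add, trace_smul, trace_smul, hX.2, hY.2, ← add_smul, hst, one_smul]

end ConvexCombinations

section HolevoBounds

variable {b : Type*} [Fintype b] [DecidableEq b] {X Y : Matrix b b ℂ}

theorem relativeEntropy_self (hX : X.IsHermitian) : relativeEntropy X X = 0 := by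
  have hfin : (spectrum ℝ X).Finite := finite_real_spectrum
  have h : cfc Real.negMulLog X = -(cfc Real.log X * X) := by
    nth_rw 3 [← cfc_id_of_isHermitian hX]
    rw [← cfc_mul _ _ X (hfin.continuousOn _) (hfin.continuousOn _), ← cfc_neg]
    congr 1
    funext x
    rw [Real.negMulLog]
    ring
  rw [relativeEntropy, vonNeumannEntropy, h, trace_neg, Complex.neg_re]
  ring

/-- Donald's identity. The Holevo information is the mean relative entropy to the midpoint, and for
any other reference point `ω` the mean relative entropy exceeds it by the relative entropy of
the midpoint. -/
theorem holevoInformation_add_relativeEntropy (X Y ω : Matrix b b ℂ) :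
    holevoInformation X Y + relativeEntropy ((1 / 2 : ℝ) • X + (1 / 2 : ℝ) • Y) ω
      = (relativeEntropy X ω + relativeEntropy Y ω) / 2 := by
  simp only [holevoInformation, relativeEntropy, mul_add, mul_smul_comm, trace_add, trace_smul,
    Complex.add_re, Complex.smul_re, smul_eq_mul]
  ring

theorem relativeEntropy_midpoint_le_holevoInformation (hX : IsState X) (hY : IsState Y) :
    relativeEntropy X ((1 / 2 : ℝ) • X + (1 / 2 : ℝ) • Y) / 2 ≤ holevoInformation X Y := by
  have hm : IsState ((1 / 2 : ℝ) • X + (1 / 2 : ℝ) • Y) :=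
    hX.convex_combination hY (by norm_num) (by norm_num) (by norm_num)
  have h := holevoInformation_add_relativeEntropy X Y ((1 / 2 : ℝ) • X + (1 / 2 : ℝ) • Y)
  rw [relativeEntropy_self hm.1.1] at h
  have h1 := hm.le_relativeEntropy hY (posSemidef_two_smul_midpoint_sub_right hX.1)
  have h2 := trace_mul_re_nonneg (posSemidef_conjTranspose_mul_self
    (Y - ((1 / 2 : ℝ) • X + (1 / 2 : ℝ) • Y))) PosSemidef.one
  rw [mul_one, (hY.1.1.sub hm.1.1).eq] at h2
  linarith

theorem holevoInformation_pos (hX : IsState X) (hY : IsState Y) (hne : X ≠ Y) :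
    0 < holevoInformation X Y := by
  have hm : IsState ((1 / 2 : ℝ) • X + (1 / 2 : ℝ) • Y) :=
    hX.convex_combination hY (by norm_num) (by norm_num) (by norm_num)
  have h1 := hm.le_relativeEntropy hX (posSemidef_two_smul_midpoint_sub_left hY.1)
  have h2 := trace_mul_self_re_pos (hX.1.1.sub hm.1.1) fun h => hne <| by
    have h3 : (2 : ℝ) • (X - ((1 / 2 : ℝ) • X + (1 / 2 : ℝ) • Y)) = 0 := by rw [h, smul_zero]
    rw [← sub_eq_zero, ← h3]
    module
  have h3 := relativeEntropy_midpoint_le_holevoInformation hX hY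
  linarith

/-- For a projection `X`, the Holevo information of `X` and `Y` is bounded below by a quantity that
is of first order in the difference of `X` and `Y`. -/
theorem one_sub_trace_mul_le_holevoInformation (hX : IsState X) (hXX : X * X = X)
    (hY : IsState Y) : (1 - (Y * X).trace.re) / 4 ≤ holevoInformation X Y := by
  have hm : IsState ((1 / 2 : ℝ) • X + (1 / 2 : ℝ) • Y) :=
    hX.convex_combination hY (by norm_num) (by norm_num) (by norm_num)
  have h1 := le_relativeEntropy_of_isIdempotentElem hm.1 hX.1 hXX
    (posSemidef_two_smul_midpoint_sub_left hY.1)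
  have h3 := relativeEntropy_midpoint_le_holevoInformation hX hY
  rw [add_mul, smul_mul_assoc, smul_mul_assoc, hXX, trace_add, trace_smul, trace_smul,
    Complex.add_re, Complex.smul_re, Complex.smul_re, hX.2, Complex.one_re, smul_eq_mul,
    smul_eq_mul] at h1
  linarith

/-- In Donald's identity with `ω = X` one of the two relative entropies vanishes. Compared with the
midpoint, this reference point has the advantage of not varying with `Y`. -/
theorem holevoInformation_le_relativeEntropy (hX : IsState X) (hY : IsState Y) {c : ℝ}
    (hc : (c • X - Y).PosSemidef) : holevoInformation X Y ≤ relativeEntropy Y X / 2 := by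
  have hm : IsState ((1 / 2 : ℝ) • X + (1 / 2 : ℝ) • Y) :=
    hX.convex_combination hY (by norm_num) (by norm_num) (by norm_num)
  have h := holevoInformation_add_relativeEntropy X Y X
  rw [relativeEntropy_self hX.1.1] at h
  have hc' : (((1 + c) / 2) • X - ((1 / 2 : ℝ) • X + (1 / 2 : ℝ) • Y)).PosSemidef := by
    convert hc.smul (by norm_num : (0 : ℝ) ≤ 1 / 2) using 1
    module
  have h1 := hX.le_relativeEntropy hm hc'
  have h2 := trace_mul_re_nonneg (posSemidef_conjTranspose_mul_self
    (((1 / 2 : ℝ) • X + (1 / 2 : ℝ) • Y) - X)) PosSemidef.one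
  rw [mul_one, (hm.1.1.sub hX.1.1).eq] at h2
  linarith

theorem IsState.trace_mul_re_lt_one (hX : IsState X) (hY : IsState Y) (hne : X ≠ Y) :
    (X * Y).trace.re < 1 := by
  have h := trace_mul_self_re_pos (hY.1.1.sub hX.1.1) (sub_ne_zero.2 hne.symm)
  rw [trace_sub_mul_sub_re] at h
  have h1 := hX.trace_mul_self_re_le_one
  have h2 := hY.trace_mul_self_re_le_one
  linarith

end HolevoBounds

/-! ### Positive maps and the channel -/

section Channels

variable {b : Type*}

theorem replaceChannel_apply (E : Matrix b b ℂ →ₗ[ℂ] Matrix b b ℂ) (t : ℝ) (X : Matrix b b ℂ) :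
    replaceChannel E t X = Real.exp (-t) • X + (1 - Real.exp (-t)) • E X := rfl

/-- Polarization: every matrix of rank one is a combination of matrices `v v*`. -/
theorem four_smul_vecMulVec_star (x y : b → ℂ) :
    (4 : ℂ) • vecMulVec x (star y) =
      vecMulVec (x + y) (star (x + y)) - vecMulVec (x - y) (star (x - y))
      + Complex.I • vecMulVec (x + Complex.I • y) (star (x + Complex.I • y))
      - Complex.I • vecMulVec (x - Complex.I • y) (star (x - Complex.I • y)) := by
  ext i j
  simp only [Matrix.smul_apply, vecMulVec_apply, Matrix.add_apply, Matrix.sub_apply, Pi.add_apply,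
    Pi.sub_apply,
    Pi.star_apply, Pi.smul_apply, smul_eq_mul, star_add, star_sub, star_mul', RCLike.star_def,
    Complex.conj_I]
  linear_combination (2 * x i * (starRingEnd ℂ) (y j) - 2 * y i * (starRingEnd ℂ) (x j))
    * Complex.I_sq

/-- A linear map other than the identity moves some pure state, since the pure states span. -/
theorem exists_isState_isIdempotentElem_map_ne [Fintype b] [DecidableEq b]
    {E : Matrix b b ℂ →ₗ[ℂ] Matrix b b ℂ} (hE : E ≠ LinearMap.id) :
    ∃ P : Matrix b b ℂ, IsState P ∧ P * P = P ∧ E P ≠ P := by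
  by_contra! h
  have hv (v : b → ℂ) : E (vecMulVec v (star v)) = vecMulVec v (star v) := by
    by_cases hv0 : v = 0
    · simp [hv0]
    have hc : 0 < star v ⬝ᵥ v := dotProduct_star_self_pos_iff.2 hv0
    set c := star v ⬝ᵥ v with hcdef
    have hfix := h (c⁻¹ • vecMulVec v (star v))
      ⟨(posSemidef_vecMulVec_self_star v).smul (inv_nonneg.2 hc.le), by
        rw [trace_smul, trace_vecMulVec, dotProduct_comm, ← hcdef, smul_eq_mul,
          inv_mul_cancel₀ hc.ne']⟩ (by
        rw [smul_mul_smul_comm, vecMulVec_mul_vecMulVec, ← hcdef, vecMulVec_smul, smul_smul]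
        field_simp)
    rw [map_smul] at hfix
    exact smul_right_injective _ (inv_ne_zero hc.ne') hfix
  have hxy (x y : b → ℂ) : E (vecMulVec x (star y)) = vecMulVec x (star y) := by
    have h4 := congrArg E (four_smul_vecMulVec_star x y)
    simp only [map_smul, map_add, map_sub, hv] at h4
    rw [← four_smul_vecMulVec_star x y] at h4
    exact smul_right_injective _ (by norm_num : (4 : ℂ) ≠ 0) h4
  refine hE (LinearMap.ext fun X => ?_)
  rw [matrix_eq_sum_single X, map_sum]
  simp only [map_sum, LinearMap.id_apply]
  refine Finset.sum_congr rfl fun i _ => Finset.sum_congr rfl fun j _ => ?_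
  have hij := hxy (Pi.single i 1) (Pi.single j 1)
  rw [← Pi.single_star, star_one, ← single_eq_single_vecMulVec_single] at hij
  rw [← mul_one (X i j), ← smul_eq_mul, ← smul_single, map_smul, hij]

section
open scoped Matrix.Norms.L2Operator MatrixOrder CStarAlgebra

theorem IsCompletelyPositive.posSemidef_map [Fintype b] [DecidableEq b]
    {E : Matrix b b ℂ →ₗ[ℂ] Matrix b b ℂ} (hE : IsCompletelyPositive E) {X : Matrix b b ℂ}
    (hX : X.PosSemidef) : (E X).PosSemidef := by
  obtain ⟨Ψ, rfl⟩ := hE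
  exact nonneg_iff_posSemidef.1 (map_nonneg Ψ (nonneg_iff_posSemidef.2 hX))

end

end Channels

theorem mainTheorem5 {a b : Type*} [Fintype a] [DecidableEq a] [Nontrivial a]
    [Fintype b] [DecidableEq b]
    (N : StarSubalgebra ℂ (Matrix b b ℂ)) (E : Matrix b b ℂ →ₗ[ℂ] Matrix b b ℂ)
    (hE : IsConditionalExpectation N E) (hcp : IsCompletelyPositive E) (hunital : E 1 = 1)
    (htrace : ∀ X, (E X).trace = X.trace) (hne : E ≠ LinearMap.id)
    (t : ℝ) (ht : 0 < t) (K : ℝ) :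
    ∃ ρ : Matrix (a × b) (a × b) ℂ, IsState ρ ∧
      0 < mutualInformation (idTensor (replaceChannel E t) ρ) ∧
      K < mutualInformation ρ / mutualInformation (idTensor (replaceChannel E t) ρ) := by
  obtain ⟨P, hP, hPP, hEP⟩ := exists_isState_isIdempotentElem_map_ne hne
  set q := Real.exp (-t) with hq
  have hq0 : 0 < q := Real.exp_pos _
  have hq1 : q < 1 := (by rw [hq, Real.exp_lt_one_iff]; linarith)
  have hEstate {X : Matrix b b ℂ} (hX : IsState X) : IsState (E X) :=
    ⟨hcp.posSemidef_map hX.1, (htrace X).trans hX.2⟩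
  have hΦstate {X : Matrix b b ℂ} (hX : IsState X) : IsState (replaceChannel E t X) :=
    replaceChannel_apply E t X ▸
      hX.convex_combination (hEstate hX) hq0.le (sub_nonneg.2 hq1.le) (add_sub_cancel q 1)
  have hEE (X : Matrix b b ℂ) : E (E X) = E X := hE.apply_of_mem _ (hE.apply_mem X)
  -- `χ` is fixed by the channel, so `τ` and the image of `(1 - ε) P + ε χ` differ by `ε (χ - τ)`.
  obtain ⟨χ, hχ⟩ : ∃ χ, χ = E P := ⟨_, rfl⟩
  have hχs : IsState χ := hχ ▸ hEstate hP
  have hχP : χ ≠ P := hχ ▸ hEP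
  obtain ⟨τ, hτ⟩ : ∃ τ, τ = replaceChannel E t P := ⟨_, rfl⟩
  have hτs : IsState τ := hτ ▸ hΦstate hP
  have hτ' : τ = q • P + (1 - q) • χ := by rw [hτ, replaceChannel_apply, hχ]
  have hΦχ : replaceChannel E t χ = χ := by
    rw [replaceChannel_apply, hχ, hEE]
    module
  have hτχ : χ - τ = q • (χ - P) := by
    rw [hτ']
    module
  obtain ⟨l, hl, hle⟩ := exists_relativeEntropy_le hτs.1
  set κ := 1 - (χ * P).trace.re with hκ
  have hκ0 : 0 < κ := sub_pos.2 (hχs.trace_mul_re_lt_one hP hχP)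
  set T := ((χ - τ) * (χ - τ)).trace.re with hT
  have hT0 : 0 < T := trace_mul_self_re_pos (hχs.1.1.sub hτs.1.1) <| by
    rw [hτχ]
    exact smul_ne_zero hq0.ne' (sub_ne_zero.2 hχP)
  -- The output information is at most `ε² T / (2 l)`, the input information at least `ε κ / 4`.
  obtain ⟨ε, hε0, hε1, hεK⟩ : ∃ ε : ℝ, 0 < ε ∧ ε < 1 ∧
      |K| * (ε ^ 2 * (T / (2 * l))) < ε * (κ / 4) := by
    have hC : 0 ≤ |K| * (T / (2 * l)) := by positivity
    set C := |K| * (T / (2 * l)) with hCdef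
    refine ⟨κ / 4 / (C + κ / 4 + 1), by positivity, ?_, ?_⟩
    · rw [div_lt_one (by positivity)]
      linarith
    · set ε := κ / 4 / (C + κ / 4 + 1) with hε
      have hε0 : 0 < ε := by positivity
      have h1 : C * ε < κ / 4 := by
        rw [hε, mul_div_assoc', div_lt_iff₀ (by positivity)]
        nlinarith
      calc |K| * (ε ^ 2 * (T / (2 * l))) = ε * (C * ε) := by rw [hCdef]; ring
        _ < ε * (κ / 4) := by gcongr
  have hY : IsState ((1 - ε) • P + ε • χ) :=
    hP.convex_combination hχs (by linarith) hε0.le (by ring)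
  have hΦY : replaceChannel E t ((1 - ε) • P + ε • χ) = (1 - ε) • τ + ε • χ := by
    rw [map_add, LinearMap.map_smul_of_tower, LinearMap.map_smul_of_tower, hΦχ, hτ]
  obtain ⟨ρ, hρ, hin, hout⟩ := exists_isState_mutualInformation_eq (a := a) hP hY
  have hΦYs : IsState ((1 - ε) • τ + ε • χ) := hΦY ▸ hΦstate hY
  have hout' := hout (replaceChannel E t) (hΦstate hP) (hΦstate hY)
  rw [hΦY, ← hτ] at hout'
  have hdiff : (1 - ε) • τ + ε • χ - τ = ε • (χ - τ) := by module
  have hpos : 0 < holevoInformation τ ((1 - ε) • τ + ε • χ) := by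
    refine holevoInformation_pos hτs hΦYs fun h => ?_
    rw [← h, sub_self, hτχ] at hdiff
    exact smul_ne_zero hε0.ne' (smul_ne_zero hq0.ne' (sub_ne_zero.2 hχP)) hdiff.symm
  have hlow : ε * (κ / 4) ≤ holevoInformation P ((1 - ε) • P + ε • χ) := by
    refine le_trans (le_of_eq ?_) (one_sub_trace_mul_le_holevoInformation hP hPP hY)
    rw [add_mul, smul_mul_assoc, smul_mul_assoc, hPP, trace_add, trace_smul, trace_smul,
      Complex.add_re, Complex.smul_re, Complex.smul_re, hP.2, Complex.one_re, smul_eq_mul,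
      smul_eq_mul, hκ]
    ring
  have hup : holevoInformation τ ((1 - ε) • τ + ε • χ) ≤ ε ^ 2 * (T / (2 * l)) := by
    -- `χ ≤ τ / (1 - q)` makes the perturbed output dominated by a multiple of `τ`.
    have hc : ((1 + 1 / (1 - q)) • τ - ((1 - ε) • τ + ε • χ)).PosSemidef := by
      have h1 : ((1 + 1 / (1 - q)) • τ - ((1 - ε) • τ + ε • χ))
          = ε • τ + (q / (1 - q)) • P + (1 - ε) • χ := by
        have h2 : (1 / (1 - q)) • τ = (q / (1 - q)) • P + χ := by
          rw [hτ', smul_add, smul_smul, smul_smul, one_div_mul_cancel (by linarith), one_smul,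
            one_div_mul_eq_div]
        rw [add_smul, h2]
        module
      rw [h1]
      exact ((hτs.1.smul hε0.le).add (hP.1.smul (div_nonneg hq0.le (by linarith)))).add
        (hχs.1.smul (by linarith))
    have h1 := holevoInformation_le_relativeEntropy hτs hΦYs hc
    have h2 := hle _ _ hΦYs.1 (hΦYs.2.trans hτs.2.symm) hc
    rw [hdiff, smul_mul_smul_comm, trace_smul, Complex.smul_re, ← hT, smul_eq_mul] at h2
    calc _ ≤ ε * ε * T / l / 2 := by linarith
      _ = _ := by field_simp
  refine ⟨ρ, hρ, hout' ▸ hpos, ?_⟩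
  rw [hout', hin, lt_div_iff₀ hpos]
  calc K * holevoInformation τ ((1 - ε) • τ + ε • χ)
      ≤ |K| * (ε ^ 2 * (T / (2 * l))) :=
        mul_le_mul (le_abs_self K) hup hpos.le (abs_nonneg K)
    _ < ε * (κ / 4) := hεK
    _ ≤ _ := hlow
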